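/- All hypergraphs are finite families $\mathcal H$ of finite sets (the edges). The rank of $\mathcal H$ is the maximal size of an edge ($0$ if there is no edge). A finite set of vertices $C$ is a cover of $\mathcal H$ if $A\cap C\neq\emptyset$ for every $A\in\mathcal H$, and the covering number $\tau(\mathcal H)$ is the minimal size of a cover ($\infty$ if there is none, i.e. if $\emptyset\in\mathcal H$). For $p\in\mathbb N=\{0,1,2,\dots\}$ let $$\mathrm{Cov}_{\mathcal H,p}=\{\mathcal F\subseteq\mathcal H:\ \tau(\mathcal F)\le p\},$$ a simplicial complex on the vertex set $\mathcal H$, with $\emptyset$ as a face. Let $X$ be a finite simplicial complex and $d\ge 0$ an integer. If $\eta\in X$ satisfies $|\eta|\le d$ and is contained in a unique maximal face $\tau$ of $X$, then $X\setminus\{\sigma\in X:\eta\subseteq\sigma\subseteq\tau\}$ is said to be obtained from $X$ by an elementary $d$-collapse (here $\eta=\emptyset$ is allowed). $X$ is $d$-collapsible if a finite sequence of elementary $d$-collapses leads from $X$ to the void complex (the complex with no faces, not even $\emptyset$). **Theorem.** Let $r,p\ge 0$ be integers. 1. For every hypergraph $\mathcal H$ of rank $r$, the complex $\mathrm{Cov}_{\mathcal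 H,p}$ is $\left(\binom{r+p}{r}-1\right)$-collapsible. 2. The bound is sharp: the complete $r$-uniform hypergraph $\mathcal H=\binom{[r+p]}{r}$ on $r+p$ vertices has rank $r$, and the least $d\ge 0$ for which $\mathrm{Cov}_{\mathcal H,p}$ is $d$-collapsible is exactly $\binom{r+p}{r}-1$. -/

import Mathlib

/-- A finite (abstract) simplicial complex with vertices in `V`: a finite, downward closed family
of finite sets. The empty set is a face unless the complex is void, i.e. has no face at all. -/
@[ext]
structure FiniteComplex (V : Type*) where
  faces : Finset (Finset V)
  down_closed : ∀ ⦃σ τ : Finset V⦄, τ ∈ faces → σ ⊆ τ → σ ∈ faces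

namespace FiniteComplex

/-- The void complex, without any face (not even the empty one). -/
def void (V : Type*) : FiniteComplex V where
  faces := ∅
  down_closed := by simp

/-- `τ` is a maximal face (a facet) of `X`. -/
def IsMaximalFace {V : Type*} (X : FiniteComplex V) (τ : Finset V) : Prop :=
  Maximal (fun σ => σ ∈ X.faces) τ

/-- `X'` is obtained from `X` by an elementary `d`-collapse: for some face `η` of `X` with
`|η| ≤ d` that is contained in a unique maximal face `τ`, all faces `σ` with `η ⊆ σ ⊆ τ` are
removed. -/
def ElementaryCollapse {V : Type*} (d : ℕ) (X X' : FiniteComplex V) : Prop :=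
  ∃ η τ : Finset V,
    η ∈ X.faces ∧ η.card ≤ d ∧
    X.IsMaximalFace τ ∧ η ⊆ τ ∧
    (∀ τ' : Finset V, X.IsMaximalFace τ' → η ⊆ τ' → τ' = τ) ∧
    ∀ σ : Finset V, σ ∈ X'.faces ↔ σ ∈ X.faces ∧ ¬ (η ⊆ σ ∧ σ ⊆ τ)

/-- `X` is `d`-collapsible: a finite sequence of elementary `d`-collapses leads from `X` to the
void complex. -/
def IsCollapsible {V : Type*} (X : FiniteComplex V) (d : ℕ) : Prop :=
  Relation.ReflTransGen (ElementaryCollapse d) X (void V)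

end FiniteComplex

/-- A finite hypergraph, identified with its edge set: a finite family of finite sets of
vertices. -/
abbrev FiniteHypergraph (α : Type*) := Finset (Finset α)

namespace FiniteHypergraph

/-- The rank: the maximal size of an edge (`0` if there is no edge). -/
def rank {α : Type*} (H : FiniteHypergraph α) : ℕ := H.sup Finset.card

/-- `C` is a cover of `H`: it meets every edge. -/
def IsCover {α : Type*} (H : FiniteHypergraph α) (C : Finset α) : Prop :=
  ∀ A ∈ H, ∃ v ∈ A, v ∈ C

/-- The covering number: the minimal size of a cover (`⊤` if there is no cover, that is, if the
empty set is an edge). -/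
noncomputable def coveringNumber {α : Type*} (H : FiniteHypergraph α) : ℕ∞ :=
  ⨅ (C : Finset α) (_ : IsCover H C), (C.card : ℕ∞)

theorem coveringNumber_mono {α : Type*} {F G : FiniteHypergraph α} (h : F ⊆ G) :
    coveringNumber F ≤ coveringNumber G :=
  le_iInf₂ fun C hC => iInf₂_le C fun A hA => hC A (h hA)

open Classical in
/-- The complex of all subhypergraphs `F ⊆ H` with covering number at most `p`; its vertices are
edges of `H`. -/
noncomputable def cov {α : Type*} (H : FiniteHypergraph α) (p : ℕ) :
    FiniteComplex (Finset α) where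
  faces := H.powerset.filter fun F => coveringNumber F ≤ (p : ℕ∞)
  down_closed := by
    intro σ τ hτ hστ
    rw [Finset.mem_filter, Finset.mem_powerset] at hτ ⊢
    exact ⟨hστ.trans hτ.1, (coveringNumber_mono hστ).trans hτ.2⟩

/-- The complete `r`-uniform hypergraph on `n` vertices. -/
def complete (n r : ℕ) : FiniteHypergraph (Fin n) := Finset.powersetCard r Finset.univ

end FiniteHypergraph

/-! `cov H p` is generated by the families `covered H C` with `|C| ≤ p`. A generated complex is
`d`-collapsible if it has no exclusion chain of length `d + 1`: remove the star of a vertex by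
collapsing its link, then continue with the deletion (`isCollapsible_generated`). Here a chain of
length `k` consists of edges `Aᵢ` and sets `Cⱼ` with `Aᵢ ∩ Cᵢ = ∅` and `Aᵢ ∩ Cⱼ ≠ ∅` for `i < j`.
Turn each `C` into a form of degree `p` in `r + 1` variables and each `A` into a point where that
form vanishes iff `A` meets `C`. The forms are then independent by triangularity, so `k + 1` is at
most the dimension `(r + p).choose r` (`lt_choose_of_hasExclusionChain`). For sharpness, the
complete hypergraph gives the boundary of a simplex, whose first collapse needs a face with all
vertices but one. -/

namespace FiniteComplex

/-! ### Collapsing generated complexes. -/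

variable {V : Type*}

open Classical in
/-- The subcomplex of those faces `σ` of `X` for which `σ.erase v` is a face of `Y` as soon as
`v ∈ σ`. -/
noncomputable def cut (X : FiniteComplex V) (v : V) (Y : FiniteComplex V) : FiniteComplex V where
  faces := X.faces.filter fun σ => v ∈ σ → σ.erase v ∈ Y.faces
  down_closed := by
    intro σ τ hτ hστ
    rw [Finset.mem_filter] at hτ ⊢
    exact ⟨X.down_closed hτ.1 hστ, fun hv =>
      Y.down_closed (hτ.2 (hστ hv)) (Finset.erase_subset_erase v hστ)⟩

open Classical in
theorem mem_cut {X Y : FiniteComplex V} {v : V} {σ : Finset V} :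
    σ ∈ (X.cut v Y).faces ↔ σ ∈ X.faces ∧ (v ∈ σ → σ.erase v ∈ Y.faces) := by
  simp [cut]

-- Adding `v` to both `η` and `τ` lifts the collapse, since the facets of `X.cut v Y` through `v`
-- correspond to the facets of `Y`. The added vertex costs one dimension.
open Classical in
theorem ElementaryCollapse.cut {X Y Y' : FiniteComplex V} {v : V} {d : ℕ}
    (hY : ∀ σ ∈ Y.faces, v ∉ σ ∧ insert v σ ∈ X.faces) (h : ElementaryCollapse d Y Y') :
    ElementaryCollapse (d + 1) (X.cut v Y) (X.cut v Y') := by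
  obtain ⟨η, τ, hη, hd, hτ, hητ, huniq, hY'⟩ := h
  have mem_insert : ∀ σ ∈ Y.faces, insert v σ ∈ (X.cut v Y).faces := fun σ hσ =>
    mem_cut.2 ⟨(hY σ hσ).2, fun _ => by rwa [Finset.erase_insert (hY σ hσ).1]⟩
  have mem_erase : ∀ σ ∈ (X.cut v Y).faces, v ∈ σ → σ.erase v ∈ Y.faces := fun σ hσ hv =>
    (mem_cut.1 hσ).2 hv
  refine ⟨insert v η, insert v τ, mem_insert η hη, ?_, ⟨mem_insert τ hτ.1, ?_⟩,
    Finset.insert_subset_insert v hητ, ?_, ?_⟩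
  · exact (Finset.card_insert_le v η).trans (by omega)
  · intro ρ hρ hτρ
    have hv : v ∈ ρ := hτρ (Finset.mem_insert_self v τ)
    have h1 : τ ⊆ ρ.erase v :=
      Finset.subset_erase.2 ⟨(Finset.subset_insert v τ).trans hτρ, (hY τ hτ.1).1⟩
    have h2 := hτ.2 (mem_erase ρ hρ hv) h1
    rw [← Finset.insert_erase hv]
    exact Finset.insert_subset_insert v h2
  · intro τ' hτ' hητ'
    have hv : v ∈ τ' := hητ' (Finset.mem_insert_self v η)
    have h1 : η ⊆ τ'.erase v :=
      Finset.subset_erase.2 ⟨(Finset.subset_insert v η).trans hητ', (hY η hη).1⟩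
    have h2 : τ'.erase v = τ := by
      refine huniq _ ⟨mem_erase τ' hτ'.1 hv, fun ρ hρ hle => ?_⟩ h1
      refine Finset.subset_erase.2 ⟨(Finset.subset_insert v ρ).trans
        (hτ'.2 (mem_insert ρ hρ) ?_), (hY ρ hρ).1⟩
      rw [← Finset.insert_erase hv]
      exact Finset.insert_subset_insert v hle
    rw [← h2, Finset.insert_erase hv]
  · intro σ
    have key : v ∈ σ → ((η ⊆ σ.erase v ∧ σ.erase v ⊆ τ) ↔
        (insert v η ⊆ σ ∧ σ ⊆ insert v τ)) := fun hv => by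
      rw [Finset.subset_erase, Finset.insert_subset_iff, Finset.subset_insert_iff]
      have := (hY η hη).1
      tauto
    rw [mem_cut, mem_cut, hY']
    have h3 : insert v η ⊆ σ → v ∈ σ := fun h => h (Finset.mem_insert_self v η)
    tauto

open Classical in
/-- If the link of `v` is `d`-collapsible, then the open star of `v` can be removed by elementary
`(d + 1)`-collapses. -/
theorem IsCollapsible.cut_void {X Y : FiniteComplex V} {v : V} {d : ℕ}
    (h : Y.IsCollapsible d)
    (hY : ∀ σ ∈ Y.faces, v ∉ σ ∧ insert v σ ∈ X.faces) :
    Relation.ReflTransGen (ElementaryCollapse (d + 1)) (X.cut v Y) (X.cut v (void V)) := by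
  unfold IsCollapsible at h
  induction h using Relation.ReflTransGen.head_induction_on with
  | refl => exact .refl
  | head h _ ih =>
    refine .head (h.cut hY) (ih fun σ hσ => ?_)
    obtain ⟨_, _, _, _, _, _, _, hiff⟩ := h
    exact hY σ ((hiff σ).1 hσ).1

open Classical in
/-- The complex of all subsets of `W` that are contained in a member of `L`. -/
noncomputable def generated (W : Finset V) (L : Finset (Finset V)) : FiniteComplex V where
  faces := W.powerset.filter fun σ => ∃ τ ∈ L, σ ⊆ τ
  down_closed := by
    intro σ τ hτ hστ
    rw [Finset.mem_filter, Finset.mem_powerset] at hτ ⊢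
    obtain ⟨h1, ρ, h2, h3⟩ := hτ
    exact ⟨hστ.trans h1, ρ, h2, hστ.trans h3⟩

theorem mem_generated {W : Finset V} {L : Finset (Finset V)} {σ : Finset V} :
    σ ∈ (generated W L).faces ↔ σ ⊆ W ∧ ∃ τ ∈ L, σ ⊆ τ := by
  simp [generated]

open Classical in
/-- There are `v₁, …, vₖ ∈ H` and `σ₁, …, σₖ₊₁ ∈ L` such that `vᵢ ∉ σᵢ` for all `i` and
`vᵢ ∈ σⱼ` for `i < j`. -/
def HasExclusionChain (H : Finset V) : ℕ → Finset (Finset V) → Prop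
  | 0, L => L.Nonempty
  | k + 1, L => ∃ v ∈ H, ∃ σ ∈ L, v ∉ σ ∧ HasExclusionChain H k (L.filter (v ∈ ·))

theorem HasExclusionChain.exists_of_succ {H : Finset V} {k : ℕ} {L : Finset (Finset V)}
    (h : HasExclusionChain H (k + 1) L) : ∃ v ∈ H, ∃ σ ∈ L, v ∉ σ ∧
      ∃ L' : Finset (Finset V), (∀ τ, τ ∈ L' ↔ τ ∈ L ∧ v ∈ τ) ∧ HasExclusionChain H k L' := by
  classical
  obtain ⟨v, hv, σ, hσ, hvσ, h⟩ := h
  exact ⟨v, hv, σ, hσ, hvσ, _, fun _ => by rw [Finset.mem_filter], h⟩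

theorem isCollapsible_of_subset {X : FiniteComplex V} {W : Finset V} (d : ℕ)
    (h : ∀ σ, σ ∈ X.faces ↔ σ ⊆ W) : X.IsCollapsible d := by
  refine .single ⟨∅, W, (h _).2 (Finset.empty_subset W), by simp, ⟨(h _).2 subset_rfl,
    fun ρ hρ _ => (h ρ).1 hρ⟩, Finset.empty_subset W, fun τ' hτ' _ => ?_, fun σ => ?_⟩
  · exact ((h τ').1 hτ'.1).antisymm (hτ'.2 ((h W).2 subset_rfl) ((h τ').1 hτ'.1))
  · simp [void, h]

open Classical in
/-- A complex without exclusion chains of length exceeding `d` is `d`-collapsible. -/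
theorem isCollapsible_generated {H : Finset V} {d : ℕ} {L : Finset (Finset V)}
    (hL : ¬ HasExclusionChain H (d + 1) L) {W : Finset V} (hW : W ⊆ H) :
    (generated W L).IsCollapsible d := by
  -- The outer induction on `|L|` handles links; the inner one on `|W \ σ|`, for a fixed `σ ∈ L`,
  -- handles deletions and ends at a full simplex.
  induction hn : L.card using Nat.strong_induction_on generalizing L d W with
  | _ n ihL =>
  obtain rfl | ⟨σ, hσ⟩ := L.eq_empty_or_nonempty
  · have : generated W ∅ = void V := by
      ext τ
      simp [mem_generated, void]
    rw [this]
    exact .refl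
  induction hm : (W \ σ).card generalizing W with
  | zero =>
    have hWσ : W ⊆ σ := by simpa using hm
    exact isCollapsible_of_subset d fun τ =>
      mem_generated.trans ⟨fun h => h.1, fun h => ⟨h, σ, hσ, h.trans hWσ⟩⟩
  | succ m ihm =>
    obtain ⟨v, hv⟩ : (W \ σ).Nonempty := Finset.card_pos.1 (by omega)
    obtain ⟨hvW, hvσ⟩ := Finset.mem_sdiff.1 hv
    have hdel : (generated (W.erase v) L).IsCollapsible d := by
      refine ihm ((Finset.erase_subset v W).trans hW) ?_
      rw [Finset.erase_sdiff_comm, Finset.card_erase_of_mem hv, hm]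
      rfl
    obtain hE | hE := (L.filter (v ∈ ·)).eq_empty_or_nonempty
    · have : generated W L = generated (W.erase v) L := by
        ext τ
        rw [mem_generated, mem_generated, Finset.subset_erase]
        refine ⟨fun ⟨h1, ρ, h2, h3⟩ => ⟨⟨h1, fun hvτ => ?_⟩, ρ, h2, h3⟩,
          fun h => ⟨h.1.1, h.2⟩⟩
        exact Finset.filter_eq_empty_iff.1 hE h2 (h3 hvτ)
      rwa [this]
    -- For `d = 0`, the vertex `v`, `σ` and a member of `L` through `v` already form a forbidden
    -- chain of length `1`.
    · obtain _ | e := d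
      · exact (hL ⟨v, hW hvW, σ, hσ, hvσ, hE⟩).elim
      have hlink : (generated (W.erase v) (L.filter (v ∈ ·))).IsCollapsible e := by
        refine ihL _ ?_ (fun h => hL ⟨v, hW hvW, σ, hσ, hvσ, h⟩)
          ((Finset.erase_subset v W).trans hW) rfl
        rw [← hn]
        exact Finset.card_lt_card (Finset.filter_ssubset.2 ⟨σ, hσ, hvσ⟩)
      have key := hlink.cut_void (X := generated W L) (v := v) (fun τ hτ => by
        rw [mem_generated, Finset.subset_erase] at hτ
        obtain ⟨⟨h1, h2⟩, ρ, h3, h4⟩ := hτ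
        rw [Finset.mem_filter] at h3
        refine ⟨h2, mem_generated.2 ⟨?_, ρ, h3.1, ?_⟩⟩ <;> intro x hx <;>
          obtain rfl | hx := Finset.mem_insert.1 hx
        exacts [hvW, h1 hx, h3.2, h4 hx])
      -- Cutting along the whole link changes nothing; cutting along the void complex deletes `v`.
      have h1 : (generated W L).cut v (generated (W.erase v) (L.filter (v ∈ ·))) =
          generated W L := by
        ext τ
        rw [mem_cut, and_iff_left_iff_imp]
        intro hτ hvτ
        obtain ⟨h1, ρ, h2, h3⟩ := mem_generated.1 hτ
        exact mem_generated.2 ⟨Finset.erase_subset_erase v h1, ρ,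
          Finset.mem_filter.2 ⟨h2, h3 hvτ⟩, (Finset.erase_subset v τ).trans h3⟩
      have h2 : (generated W L).cut v (void V) = generated (W.erase v) L := by
        ext τ
        rw [mem_cut, mem_generated, mem_generated, Finset.subset_erase]
        simp only [void, Finset.notMem_empty, imp_false]
        tauto
      rw [h1, h2] at key
      exact key.trans hdel

end FiniteComplex

/-! ### The skew set pair inequality via homogeneous polynomials. -/

namespace FiniteHypergraph

section CoverPolynomial

variable {α K : Type*} [Field K]

/-- The number of monomials bounds the dimension of the space of homogeneous polynomials. -/
theorem finrank_homogeneousSubmodule_le (r p : ℕ) :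
    Module.finrank K (MvPolynomial.homogeneousSubmodule (Fin (r + 1)) K p) ≤ (r + p).choose r ∧
      FiniteDimensional K (MvPolynomial.homogeneousSubmodule (Fin (r + 1)) K p) := by
  classical
  refine ⟨?_, Module.Finite.iff_fg.2 (MvPolynomial.homogeneousSubmodule_fg _ _ p)⟩
  have h : MvPolynomial.homogeneousSubmodule (Fin (r + 1)) K p =
      Submodule.span K (((Finset.univ.finsuppAntidiag p).image
        fun d => MvPolynomial.monomial d (1 : K) :
          Finset (MvPolynomial (Fin (r + 1)) K)) : Set (MvPolynomial (Fin (r + 1)) K)) := by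
    rw [MvPolynomial.homogeneousSubmodule_eq_finsupp_supported,
      AddMonoidAlgebra.supported_eq_span_single]
    congr 1
    ext f
    simp [MvPolynomial.single_eq_monomial, Finsupp.degree_eq_sum]
  rw [h]
  refine (finrank_span_finset_le_card _).trans (Finset.card_image_le.trans ?_)
  rw [Finset.card_finsuppAntidiag_nat_eq_choose, Finset.card_univ, Fintype.card_fin,
    Nat.choose_symm_add]
  exact le_of_eq (congrArg₂ _ (by omega) rfl)

/-- The homogeneous polynomial of degree `p` in the coefficients of a polynomial `P` of degree at
most `r` which for monic `P` of degree `r` takes the value `∏ c ∈ C, P (ι c)`. -/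
noncomputable def coverPolynomial (ι : α → K) (r p : ℕ) (C : Finset α) :
    MvPolynomial (Fin (r + 1)) K :=
  MvPolynomial.X (Fin.last r) ^ (p - C.card) *
    ∏ c ∈ C, ∑ k : Fin (r + 1), MvPolynomial.C (ι c ^ (k : ℕ)) * MvPolynomial.X k

/-- A monic polynomial of degree `r` whose nonzero roots are the `ι a` with `a ∈ A`. -/
noncomputable def edgePolynomial (ι : α → K) (r : ℕ) (A : Finset α) : Polynomial K :=
  Polynomial.X ^ (r - A.card) * ∏ a ∈ A, (Polynomial.X - Polynomial.C (ι a))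

theorem isHomogeneous_coverPolynomial (ι : α → K) (r : ℕ) {p : ℕ} {C : Finset α}
    (hC : C.card ≤ p) : (coverPolynomial ι r p C).IsHomogeneous p := by
  have h := (MvPolynomial.isHomogeneous_X_pow (R := K) (Fin.last r) (p - C.card)).mul
    (MvPolynomial.IsHomogeneous.prod C
      (fun c => ∑ k : Fin (r + 1), MvPolynomial.C (ι c ^ (k : ℕ)) * MvPolynomial.X k)
      (fun _ => 1) fun c _ => MvPolynomial.IsHomogeneous.sum _ _ _ fun k _ =>
        MvPolynomial.isHomogeneous_C_mul_X _ _)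
  rwa [Finset.sum_const, smul_eq_mul, mul_one, Nat.sub_add_cancel hC] at h

theorem monic_edgePolynomial (ι : α → K) (r : ℕ) (A : Finset α) :
    (edgePolynomial ι r A).Monic :=
  (Polynomial.monic_X_pow _).mul (Polynomial.monic_prod_X_sub_C ι A)

theorem natDegree_edgePolynomial (ι : α → K) {r : ℕ} {A : Finset α} (hA : A.card ≤ r) :
    (edgePolynomial ι r A).natDegree = r := by
  rw [edgePolynomial, (Polynomial.monic_X_pow _).natDegree_mul (Polynomial.monic_prod_X_sub_C ι A),
    Polynomial.natDegree_X_pow, Polynomial.natDegree_finsetProd_X_sub_C_eq_card]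
  omega

/-- The value is the product of the edge polynomial at the points `ι c`. The padding powers are
harmless: the last coefficient is `1`, and the extra root `0` is not in the range of `ι`. -/
theorem eval_coverPolynomial_eq_zero_iff {ι : α → K} (hι : Function.Injective ι)
    (h0 : ∀ a, ι a ≠ 0) {r : ℕ} (p : ℕ) {A : Finset α} (hA : A.card ≤ r) (C : Finset α) :
    MvPolynomial.eval (fun k : Fin (r + 1) => (edgePolynomial ι r A).coeff k)
      (coverPolynomial ι r p C) = 0 ↔ ¬ Disjoint A C := by
  have hlast : (edgePolynomial ι r A).coeff r = 1 := by
    have := monic_edgePolynomial ι r A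
    rwa [Polynomial.Monic, Polynomial.leadingCoeff, natDegree_edgePolynomial ι hA] at this
  have heval (c : α) : ∑ k : Fin (r + 1), ι c ^ (k : ℕ) * (edgePolynomial ι r A).coeff k =
      (edgePolynomial ι r A).eval (ι c) := by
    rw [Polynomial.eval_eq_sum_range, natDegree_edgePolynomial ι hA,
      Fin.sum_univ_eq_sum_range fun k => ι c ^ k * (edgePolynomial ι r A).coeff k]
    exact Finset.sum_congr rfl fun k _ => mul_comm _ _
  simp only [coverPolynomial, map_mul, map_pow, map_prod, map_sum, MvPolynomial.eval_X,
    MvPolynomial.eval_C, Fin.val_last, hlast, one_pow, one_mul, heval]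
  simp only [edgePolynomial, Polynomial.eval_mul, Polynomial.eval_pow, Polynomial.eval_X,
    Polynomial.eval_prod, Polynomial.eval_sub, Polynomial.eval_C, Finset.prod_eq_zero_iff,
    mul_eq_zero, pow_eq_zero_iff', h0, false_and, false_or, sub_eq_zero, hι.eq_iff,
    Finset.not_disjoint_iff]
  exact ⟨fun ⟨c, hc, a, ha, h⟩ => ⟨a, ha, h ▸ hc⟩, fun ⟨a, ha, hc⟩ => ⟨a, hc, a, ha, rfl⟩⟩

open Classical in
/-- The edges of `H` which meet `C`. -/
noncomputable def covered (H : FiniteHypergraph α) (C : Finset α) : FiniteHypergraph α :=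
  H.filter fun A => ¬ Disjoint A C

theorem mem_covered {H : FiniteHypergraph α} {A C : Finset α} :
    A ∈ covered H C ↔ A ∈ H ∧ ¬ Disjoint A C := by
  simp [covered]

/-- Each link of the chain shrinks the span strictly: at the point of the edge `A`, all forms kept
in `L'` vanish, while the form of a `C` disjoint from `A` does not. -/
theorem le_finrank_of_hasExclusionChain {ι : α → K} (hι : Function.Injective ι)
    (h0 : ∀ a, ι a ≠ 0) {H : FiniteHypergraph α} {r p : ℕ} (hr : ∀ A ∈ H, A.card ≤ r) {k : ℕ}
    {L : Finset (FiniteHypergraph α)} (hL : ∀ F ∈ L, ∃ C : Finset α, C.card ≤ p ∧ covered H C = F)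
    (h : FiniteComplex.HasExclusionChain H k L) :
    k + 1 ≤ Module.finrank K (Submodule.span K {f | ∃ C : Finset α, C.card ≤ p ∧
      covered H C ∈ L ∧ coverPolynomial ι r p C = f}) := by
  -- Strict monotonicity of `finrank` requires finite dimension.
  have hfin (L : Finset (FiniteHypergraph α)) : FiniteDimensional K (Submodule.span K {f |
      ∃ C : Finset α, C.card ≤ p ∧ covered H C ∈ L ∧ coverPolynomial ι r p C = f}) := by
    have := (finrank_homogeneousSubmodule_le (K := K) r p).2
    refine Submodule.finiteDimensional_of_le
      (S₂ := MvPolynomial.homogeneousSubmodule (Fin (r + 1)) K p) (Submodule.span_le.2 ?_)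
    rintro _ ⟨C, hC, -, rfl⟩
    exact isHomogeneous_coverPolynomial ι r hC
  induction k generalizing L with
  | zero =>
    obtain ⟨F, hF⟩ := h
    obtain ⟨C, hC, rfl⟩ := hL F hF
    have := hfin L
    refine Submodule.one_le_finrank_iff.2 fun hbot => ?_
    have hz : coverPolynomial ι r p C = 0 := by
      rw [← Submodule.mem_bot K, ← hbot]
      exact Submodule.subset_span ⟨C, hC, hF, rfl⟩
    -- The point of the empty set shows that the last form is nonzero; this gives the `+ 1`.
    refine (eval_coverPolynomial_eq_zero_iff hι h0 p (A := ∅) (Nat.zero_le r) C).1 ?_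
      (Finset.disjoint_empty_left C)
    rw [hz, map_zero]
  | succ k ih =>
    obtain ⟨A, hA, F, hF, hAF, L', hL', hchain⟩ := h.exists_of_succ
    obtain ⟨C, hC, rfl⟩ := hL F hF
    have hlt := ih (fun F hF => hL F ((hL' F).1 hF).1) hchain
    have := hfin L
    refine Nat.succ_le_of_lt (hlt.trans_lt (Submodule.finrank_lt_finrank_of_lt ?_))
    refine lt_of_le_of_ne (Submodule.span_mono ?_) fun heq => ?_
    · rintro _ ⟨C', h1, h2, rfl⟩
      exact ⟨C', h1, ((hL' _).1 h2).1, rfl⟩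
    · have hker : Submodule.span K {f | ∃ C' : Finset α, C'.card ≤ p ∧
          covered H C' ∈ L' ∧ coverPolynomial ι r p C' = f} ≤
          LinearMap.ker (MvPolynomial.aeval
            fun k : Fin (r + 1) => (edgePolynomial ι r A).coeff k).toLinearMap := by
        refine Submodule.span_le.2 ?_
        rintro _ ⟨C', h1, h2, rfl⟩
        rw [SetLike.mem_coe, LinearMap.mem_ker, AlgHom.toLinearMap_apply,
          MvPolynomial.aeval_eq_eval]
        exact (eval_coverPolynomial_eq_zero_iff hι h0 p (hr A hA) C').2
          (mem_covered.1 ((hL' _).1 h2).2).2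
      rw [heq] at hker
      have hzero := hker (Submodule.subset_span ⟨C, hC, hF, rfl⟩)
      rw [LinearMap.mem_ker, AlgHom.toLinearMap_apply, MvPolynomial.aeval_eq_eval] at hzero
      exact hAF (mem_covered.2 ⟨hA,
        (eval_coverPolynomial_eq_zero_iff hι h0 p (hr A hA) C).1 hzero⟩)

end CoverPolynomial

variable {α : Type*}

/-- A skew version of Bollobás' set pair inequality. -/
theorem lt_choose_of_hasExclusionChain {H : FiniteHypergraph α} {r p k : ℕ}
    (hr : ∀ A ∈ H, A.card ≤ r) {L : Finset (FiniteHypergraph α)}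
    (hL : ∀ F ∈ L, ∃ C : Finset α, C.card ≤ p ∧ covered H C = F)
    (h : FiniteComplex.HasExclusionChain H k L) : k < (r + p).choose r := by
  -- With the vertices as indeterminates, any vertex type embeds into the nonzero elements of a
  -- field.
  let K := FractionRing (MvPolynomial α ℚ)
  let ι : α → K := fun a => algebraMap (MvPolynomial α ℚ) K (MvPolynomial.X a)
  have hinj := IsFractionRing.injective (MvPolynomial α ℚ) K
  have hι : Function.Injective ι := hinj.comp (MvPolynomial.X_injective (σ := α) (R := ℚ))
  have h0 (a : α) : ι a ≠ 0 := fun ha =>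
    MvPolynomial.X_ne_zero (R := ℚ) a (hinj (ha.trans (map_zero _).symm))
  have hfin := (finrank_homogeneousSubmodule_le (K := K) r p).2
  refine Nat.lt_of_succ_le ((le_finrank_of_hasExclusionChain hι h0 hr hL h).trans
    ((Submodule.finrank_mono (Submodule.span_le.2 ?_)).trans
      (finrank_homogeneousSubmodule_le (K := K) r p).1))
  rintro _ ⟨C, hC, -, rfl⟩
  exact isHomogeneous_coverPolynomial ι r hC

/-! ### The covering complex, in general and for the complete hypergraph. -/

theorem coveringNumber_le_iff {F : FiniteHypergraph α} {p : ℕ} :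
    coveringNumber F ≤ p ↔ ∃ C : Finset α, C.card ≤ p ∧ IsCover F C := by
  refine ⟨fun h => ?_, fun ⟨C, hC, hF⟩ => (iInf₂_le C hF).trans (by exact_mod_cast hC)⟩
  by_contra! hcon
  have : ((p + 1 : ℕ) : ℕ∞) ≤ coveringNumber F := le_iInf₂ fun C hC => by
    exact_mod_cast Nat.succ_le_of_lt (not_le.1 fun hle => hcon C hle hC)
  have := this.trans h
  norm_cast at this
  omega

theorem mem_cov {H F : FiniteHypergraph α} {p : ℕ} :
    F ∈ (cov H p).faces ↔ F ⊆ H ∧ ∃ C : Finset α, C.card ≤ p ∧ IsCover F C := by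
  rw [← coveringNumber_le_iff]
  simp [cov]

-- Since `α` may be infinite, only sets `C` inside the union of the edges are used; intersecting a
-- cover with that union keeps it a cover.
open Classical in
theorem cov_eq_generated (H : FiniteHypergraph α) (p : ℕ) :
    cov H p = FiniteComplex.generated H
      (((H.sup id).powerset.filter fun C => C.card ≤ p).image (covered H)) := by
  ext F
  rw [mem_cov, FiniteComplex.mem_generated]
  refine and_congr_right fun hF => ⟨fun ⟨C, hC, hcov⟩ => ?_, ?_⟩
  · refine ⟨covered H (C ∩ H.sup id), Finset.mem_image_of_mem _ (Finset.mem_filter.2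
      ⟨Finset.mem_powerset.2 Finset.inter_subset_right,
        (Finset.card_le_card Finset.inter_subset_left).trans hC⟩), fun A hA => ?_⟩
    obtain ⟨v, hvA, hvC⟩ := hcov A hA
    exact mem_covered.2 ⟨hF hA, Finset.not_disjoint_iff.2 ⟨v, hvA, Finset.mem_inter.2
      ⟨hvC, Finset.mem_sup.2 ⟨A, hF hA, hvA⟩⟩⟩⟩
  · rintro ⟨_, hτ, hFτ⟩
    obtain ⟨C, hC, rfl⟩ := Finset.mem_image.1 hτ
    exact ⟨C, (Finset.mem_filter.1 hC).2, fun A hA =>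
      Finset.not_disjoint_iff.1 (mem_covered.1 (hFτ hA)).2⟩

theorem isCollapsible_cov (H : FiniteHypergraph α) (p : ℕ) :
    (cov H p).IsCollapsible ((rank H + p).choose (rank H) - 1) := by
  classical
  rw [cov_eq_generated]
  refine FiniteComplex.isCollapsible_generated (fun h => ?_) subset_rfl
  have := lt_choose_of_hasExclusionChain (r := rank H) (p := p)
    (fun A hA => Finset.le_sup (f := Finset.card) hA) (fun F hF => ?_) h
  · omega
  · obtain ⟨C, hC, rfl⟩ := Finset.mem_image.1 hF
    exact ⟨C, (Finset.mem_filter.1 hC).2, rfl⟩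

theorem rank_complete (r p : ℕ) : rank (complete (r + p) r) = r := by
  refine le_antisymm (Finset.sup_le fun A hA => (Finset.mem_powersetCard.1 hA).2.le) ?_
  obtain ⟨A, hA, hc⟩ := Finset.exists_subset_card_eq
    (s := (Finset.univ : Finset (Fin (r + p)))) (n := r) (by simp)
  exact hc.ge.trans (Finset.le_sup (f := Finset.card) (Finset.mem_powersetCard.2 ⟨hA, hc⟩))

/-- For the complete hypergraph, the complex is the boundary of a simplex. -/
theorem mem_cov_complete {r p : ℕ} {F : FiniteHypergraph (Fin (r + p))} :
    F ∈ (cov (complete (r + p) r) p).faces ↔ F ⊂ complete (r + p) r := by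
  classical
  rw [mem_cov, Finset.ssubset_iff_subset_ne]
  refine and_congr_right fun hF => ⟨?_, fun hne => ?_⟩
  · rintro ⟨C, hC, hcov⟩ rfl
    -- At least `r` vertices lie outside `C`, so some edge avoids `C`.
    obtain ⟨A, hA, hc⟩ := Finset.exists_subset_card_eq (s := Cᶜ) (n := r) (by
      rw [Finset.card_compl, Fintype.card_fin]
      omega)
    obtain ⟨v, hvA, hvC⟩ := hcov A (Finset.mem_powersetCard.2 ⟨Finset.subset_univ A, hc⟩)
    exact Finset.mem_compl.1 (hA hvA) hvC
  · obtain ⟨A, hA, hAF⟩ := Finset.exists_of_ssubset (hF.ssubset_of_ne hne)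
    have hAc := (Finset.mem_powersetCard.1 hA).2
    -- The complement of a missing edge `A` has `p` vertices and meets every `r`-set except `A`.
    refine ⟨Aᶜ, by rw [Finset.card_compl, Fintype.card_fin]; omega, fun B hB => ?_⟩
    by_contra! hcon
    have hBA : B ⊆ A := fun v hv => by simpa using hcon v hv
    have hBc := (Finset.mem_powersetCard.1 (hF hB)).2
    exact hAF (Finset.eq_of_subset_of_card_le hBA (by omega) ▸ hB)

end FiniteHypergraph

/-! ### Sharpness: collapsing the boundary of a simplex. -/

namespace FiniteComplex

variable {V : Type*}

/-- The facets containing `η` are the sets `S.erase v` with `v ∈ S \ η`. Uniqueness in the first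
collapse thus leaves at most one vertex outside `η`. -/
theorem card_le_of_isCollapsible_boundary {X : FiniteComplex V} {S : Finset V} {d : ℕ}
    (hS : S.Nonempty) (hX : ∀ σ, σ ∈ X.faces ↔ σ ⊂ S) (h : X.IsCollapsible d) :
    S.card ≤ d + 1 := by
  classical
  obtain rfl | ⟨Y, ⟨η, τ, hη, hd, -, -, huniq, -⟩, -⟩ := Relation.ReflTransGen.cases_head h
  · exact absurd ((hX ∅).2 (Finset.empty_ssubset.2 hS)) (by simp [void])
  · by_contra! hlt
    have hηS := ((hX η).1 hη).subset
    have hmax (v : V) (hv : v ∈ S \ η) : v ∈ S ∧ S.erase v = τ := by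
      obtain ⟨hvS, hvη⟩ := Finset.mem_sdiff.1 hv
      refine ⟨hvS, huniq _ ⟨(hX _).2 (Finset.erase_ssubset hvS), fun ρ hρ hle => ?_⟩
        (Finset.subset_erase.2 ⟨hηS, hvη⟩)⟩
      have hρS := (hX ρ).1 hρ
      refine Finset.subset_erase.2 ⟨hρS.subset, fun hvρ => hρS.not_subset ?_⟩
      rw [← Finset.insert_erase hvS]
      exact Finset.insert_subset hvρ hle
    obtain ⟨v, hv, w, hw, hne⟩ := Finset.one_lt_card.1 (show 1 < (S \ η).card by
      rw [Finset.card_sdiff_of_subset hηS]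
      omega)
    have hvw : v ∈ S.erase w := Finset.mem_erase.2 ⟨hne, (hmax v hv).1⟩
    rw [(hmax w hw).2, ← (hmax v hv).2] at hvw
    exact Finset.notMem_erase v S hvw

end FiniteComplex

theorem mainTheorem1 (r p : ℕ) :
    (∀ (α : Type*) (H : FiniteHypergraph α), FiniteHypergraph.rank H = r →
      (FiniteHypergraph.cov H p).IsCollapsible ((r + p).choose r - 1)) ∧
    (FiniteHypergraph.rank (FiniteHypergraph.complete (r + p) r) = r ∧
      IsLeast {d : ℕ |
          (FiniteHypergraph.cov (FiniteHypergraph.complete (r + p) r) p).IsCollapsible d}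
        ((r + p).choose r - 1)) := by
  refine ⟨fun α H hr => hr ▸ FiniteHypergraph.isCollapsible_cov H p,
    FiniteHypergraph.rank_complete r p, ?_, fun d hd => ?_⟩
  · have h := FiniteHypergraph.isCollapsible_cov (FiniteHypergraph.complete (r + p) r) p
    rwa [FiniteHypergraph.rank_complete] at h
  · have hcard : (FiniteHypergraph.complete (r + p) r).card = (r + p).choose r := by
      simp [FiniteHypergraph.complete]
    have h := FiniteComplex.card_le_of_isCollapsible_boundary
      (Finset.card_pos.1 (hcard ▸ Nat.choose_pos (Nat.le_add_right r p)))
      (fun _ => FiniteHypergraph.mem_cov_complete) hd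
    omega
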